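/- **Adaptive multiple intent ranking.** There are $n$ results (the set $U$) and $m$ user-types. Type $i$ has an interest-set $S_i\subseteq U$, a threshold $K_i$ with $1\le K_i\le |S_i|$, and a probability $p_i\ge 0$, where $\sum_i p_i=1$. A solution is a binary decision tree whose internal nodes are labelled by results; a user of type $i$ traces the path that takes the yes-branch at a node labelled $e$ if $e\in S_i$ and the no-branch otherwise. The tree is feasible if for every type $i$ its path contains at least $K_i$ distinct results of $S_i$. The cost of type $i$ is the length of the shortest prefix of its path that contains at least $K_i$ distinct results of $S_i$, and the cost of the tree is the expected cost of a type drawn from $(p_i)$. Put $f_i(X)=\min(|X\cap S_i|,K_i)/K_i$ for $X\subseteq U$. The greedy algorithm keeps the set $E$ of results displayed so far and the set $H$ of types that are compatible with the feedback received and not yet satisfied (initially $E=\emptyset$, $H=\{1,\dots,m\}$). While $H\neq\emptyset$, it displays a result $e\in U\setminus E$ that maximizes $$\sum_{j\in L_e(H)}p_j+\sum_{i\in H}p_i\,\frac{f_i(E\cup\{e\})-f_i(E)}{1-f_i(E)},$$ where $L_e(H)$ is a smaller one of the two sets $\{i\in H: e\in S_i\}$ and $\{i\in H:e\notin S_i\}$;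 all ties are broken arbitrarily. Then: 1. Each $f_i$ is monotone and submodular with $f_i(\emptyset)=0$, $f_i(S_i)=1$ and $f_i(X)=f_i(X\cap S_i)$, so that these functions with unit costs form an instance of adaptive submodular ranking (find a decision tree of minimum expected cost such that $f_i\ge 1$ on the path of every $i$, the cost of $i$ being the cost of the shortest such prefix). It has the same feasible trees with the same expected costs. The parameter $\varepsilon$ of this instance, i.e. the smallest positive value of $f_i(X\cup\{e\})-f_i(X)$ over all $i$, $X$, $e$, equals $1/\max_i K_i$. 2. There is an absolute constant $C$ such that on every instance every outcome of the greedy algorithm is a feasible tree whose expected cost is at most $C\,(1+\log\max_i K_i+\log m)$ times the expected cost of any feasible tree. That is, the algorithm is an $O(\log\max_i K_i+\log m)$-approximation. 3. The algorithm can be implemented so that it computes its whole decision tree with a number of elementary operations (reading an input entry, an arithmetic operation or comparison, a step of a list traversal) that is polynomial in $n+m$. -/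

import Mathlib

noncomputable section

namespace AdaptiveRanking

/-! ### Adaptive solutions -/

/-- A binary decision tree whose internal nodes are labelled by elements of `U`.
In `node e yes no`, the subtree `yes` is entered by the scenarios whose interest-set contains `e`,
and `no` by the others. -/
inductive DecisionTree (U : Type) : Type
  | leaf : DecisionTree U
  | node (e : U) (yes no : DecisionTree U) : DecisionTree U

/-- The sequence of elements on the root-leaf path traced by a scenario with interest-set `S`. -/
def DecisionTree.path {U : Type} [DecidableEq U] (S : Finset U) : DecisionTree U → List U
  | .leaf => []
  | .node e yes no => e :: (if e ∈ S then path S yes else path S no)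

/-! ### Adaptive submodular ranking -/

/-- An instance of adaptive submodular ranking with `n` elements and `m` scenarios: element costs
`c`, interest-sets `S i`, normalized monotone submodular functions `f i` (extended from subsets of
`S i` to all sets of elements by `f i X = f i (X ∩ S i)`), and a probability distribution `p` on
the scenarios. -/
structure ASR (n m : ℕ) where
  c : Fin n → ℝ
  c_pos : ∀ e, 0 < c e
  S : Fin m → Finset (Fin n)
  f : Fin m → Finset (Fin n) → ℝ
  f_inter : ∀ i X, f i X = f i (X ∩ S i)
  f_empty : ∀ i, f i ∅ = 0
  f_full : ∀ i, f i (S i) = 1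
  f_mono : ∀ i X Y, X ⊆ Y → f i X ≤ f i Y
  f_submodular : ∀ i X Y, f i (X ∩ Y) + f i (X ∪ Y) ≤ f i X + f i Y
  p : Fin m → ℝ
  p_nonneg : ∀ i, 0 ≤ p i
  p_sum : ∑ i, p i = 1

namespace ASR

variable {n m : ℕ} (A : ASR n m)

/-- The tree satisfies every scenario. -/
def Feasible (T : DecisionTree (Fin n)) : Prop :=
  ∀ i, 1 ≤ A.f i (T.path (A.S i)).toFinset

/-- The cost of scenario `i`: the cost of the shortest prefix of its path that satisfies it
(meaningful if the path satisfies `i`). -/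
def cost (T : DecisionTree (Fin n)) (i : Fin m) : ℝ :=
  (((T.path (A.S i)).take
    (sInf {k : ℕ | 1 ≤ A.f i ((T.path (A.S i)).take k).toFinset})).map A.c).sum

/-- The expected cost to satisfy the random scenario. -/
def expectedCost (T : DecisionTree (Fin n)) : ℝ := ∑ i, A.p i * A.cost T i

/-- The set of all positive increments `f i (X ∪ {e}) - f i X`; its least element is the
parameter `ε` of the instance. -/
def positiveIncrements : Set ℝ :=
  {x | ∃ (i : Fin m) (X : Finset (Fin n)) (e : Fin n),
    A.f i X < A.f i (insert e X) ∧ x = A.f i (insert e X) - A.f i X}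

/-! #### The adaptive greedy algorithm -/

/-- `L` is a smallest one among the two parts `{i ∈ H | e ∈ S i}` and `{i ∈ H | e ∉ S i}`
(either of them in the case of a tie). -/
def IsMinorityPart (H : Finset (Fin m)) (e : Fin n) (L : Finset (Fin m)) : Prop :=
  (L = H.filter (fun i => e ∈ A.S i) ∧
      (H.filter (fun i => e ∈ A.S i)).card ≤ (H.filter (fun i => e ∉ A.S i)).card) ∨
  (L = H.filter (fun i => e ∉ A.S i) ∧
      (H.filter (fun i => e ∉ A.S i)).card ≤ (H.filter (fun i => e ∈ A.S i)).card)

/-- The score of the element `e` in the state `(E, H)`, where `L` is the part chosen for `e`. -/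
def score (E : Finset (Fin n)) (H L : Finset (Fin m)) (e : Fin n) : ℝ :=
  1 / A.c e * (∑ j ∈ L, A.p j +
    ∑ i ∈ H, A.p i * ((A.f i (insert e E) - A.f i E) / (1 - A.f i E)))

/-- `A.IsGreedy E H T`: the tree `T` is a possible behaviour of the greedy algorithm from the state
`(E, H)` on, where `E` is the set of the elements displayed so far and `H` is the set of the
scenarios that are compatible with the feedback and still uncovered. While `H` is non-empty, the
algorithm displays an element outside `E` of maximum score; ties are broken arbitrarily. -/
inductive IsGreedy : Finset (Fin n) → Finset (Fin m) → DecisionTree (Fin n) → Prop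
  | finished (E : Finset (Fin n)) : IsGreedy E ∅ .leaf
  | step (E : Finset (Fin n)) (H : Finset (Fin m)) (hH : H.Nonempty)
      (L : Fin n → Finset (Fin m)) (hL : ∀ a, A.IsMinorityPart H a (L a))
      (e : Fin n) (he : e ∉ E) (hmax : ∀ a, a ∉ E → A.score E H (L a) a ≤ A.score E H (L e) e)
      (yes no : DecisionTree (Fin n))
      (hyes : IsGreedy (insert e E)
        (H.filter (fun i => e ∈ A.S i ∧ A.f i (insert e E) < 1)) yes)
      (hno : IsGreedy (insert e E)
        (H.filter (fun i => e ∉ A.S i ∧ A.f i (insert e E) < 1)) no) :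
      IsGreedy E H (.node e yes no)

/-- The possible outcomes of the greedy algorithm: nothing has been displayed yet, and all
scenarios are possible. -/
def IsGreedyTree (T : DecisionTree (Fin n)) : Prop := A.IsGreedy ∅ Finset.univ T

end ASR

/-! ### A step-counting implementation of the algorithm

Programs are written in a monad that counts elementary operations: reading an input entry (such as
the bit `e ∈ S i` or the number `p i`), one arithmetic operation, one comparison, one step of a
list traversal or of the construction of the output. -/

/-- A result together with the number of elementary operations spent on it. -/
structure Timed (α : Type) where
  val : α
  ticks : ℕ

instance : Monad Timed where
  pure x := ⟨x, 0⟩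
  bind x g := ⟨(g x.val).val, x.ticks + (g x.val).ticks⟩

namespace Timed

/-- One elementary operation with result `x`. -/
def tick {α : Type} (x : α) : Timed α := ⟨x, 1⟩

def filter {α : Type} (q : α → Timed Bool) : List α → Timed (List α)
  | [] => tick []
  | a :: l => do
    let b ← q a
    let r ← filter q l
    tick (if b then a :: r else r)

def length {α : Type} : List α → Timed ℕ
  | [] => tick 0
  | _ :: l => do
    let k ← length l
    tick (k + 1)

def sum {α : Type} (g : α → Timed ℝ) : List α → Timed ℝ
  | [] => tick 0
  | a :: l => do
    let x ← g a
    let s ← sum g l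
    tick (x + s)

/-- Linear search of an element in a list. -/
def mem {n : ℕ} (e : Fin n) : List (Fin n) → Timed Bool
  | [] => tick false
  | a :: l => do
    let b ← tick (decide (e = a))
    let r ← mem e l
    tick (b || r)

/-- An entry of a list with the largest value of `g`, together with that value. -/
def argmax {α : Type} (g : α → Timed ℝ) : List α → Timed (Option (α × ℝ))
  | [] => tick none
  | a :: l => do
    let x ← g a
    let r ← argmax g l
    match r with
    | none => tick (some (a, x))
    | some (b, y) => tick (if y ≤ x then some (a, x) else some (b, y))

end Timed

namespace ASR

open Timed

variable {n m : ℕ} (A : ASR n m)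

/-- Computes a smallest part of `H` with respect to `e`. -/
def minorityPart (H : List (Fin m)) (e : Fin n) : Timed (List (Fin m)) := do
  let Y ← Timed.filter (fun i => tick (decide (e ∈ A.S i))) H
  let N ← Timed.filter (fun i => tick (decide (e ∉ A.S i))) H
  let y ← Timed.length Y
  let z ← Timed.length N
  tick (if y ≤ z then Y else N)

/-- Computes the score of `e` in the state `(E, H)`, given a program `oracle` that evaluates the
functions `f i`. -/
def computeScore (oracle : Fin m → List (Fin n) → Timed ℝ)
    (E : List (Fin n)) (H : List (Fin m)) (e : Fin n) : Timed ℝ := do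
  let L ← A.minorityPart H e
  let a ← Timed.sum (fun j => tick (A.p j)) L
  let b ← Timed.sum (fun i => do
    let x ← oracle i (e :: E)
    let y ← oracle i E
    let d ← tick (x - y)
    let r ← tick (1 - y)
    let t ← tick (d / r)
    let w ← tick (A.p i)
    tick (w * t)) H
  let s ← tick (a + b)
  let w ← tick (A.c e)
  tick (s / w)

/-- Computes the decision tree of the greedy algorithm from the state `(E, H)` on. The first
numerical argument bounds the number of elements that may still be displayed on a path. -/
def buildTree (oracle : Fin m → List (Fin n) → Timed ℝ) :
    ℕ → List (Fin n) → List (Fin m) → Timed (DecisionTree (Fin n))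
  | 0, _, _ => tick .leaf
  | _ + 1, _, [] => tick .leaf
  | k + 1, E, j :: H => do
    let R ← Timed.filter (fun e => do
      let b ← Timed.mem e E
      tick (!b)) (List.finRange n)
    let r ← Timed.argmax (A.computeScore oracle E (j :: H)) R
    match r with
    | none => tick .leaf
    | some (e, _) => do
      let V ← Timed.filter (fun i => do
        let x ← oracle i (e :: E)
        tick (decide (x < 1))) (j :: H)
      let Y ← Timed.filter (fun i => tick (decide (e ∈ A.S i))) V
      let N ← Timed.filter (fun i => tick (decide (e ∉ A.S i))) V
      let yes ← buildTree oracle k (e :: E) Y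
      let no ← buildTree oracle k (e :: E) N
      tick (.node e yes no)

/-- The greedy algorithm: it starts with nothing displayed and with all scenarios possible. -/
def greedyProgram (oracle : Fin m → List (Fin n) → Timed ℝ) : Timed (DecisionTree (Fin n)) :=
  A.buildTree oracle n [] (List.finRange m)

end ASR

/-! ### Adaptive multiple intent ranking -/

/-- An instance of adaptive multiple intent ranking with `n` results and `m` user-types: user-type
`i` has probability `p i` and is satisfied after seeing `K i` results from the set `S i`. -/
structure MIR (n m : ℕ) where
  S : Fin m → Finset (Fin n)
  K : Fin m → ℕ
  K_pos : ∀ i, 1 ≤ K i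
  K_le : ∀ i, K i ≤ (S i).card
  p : Fin m → ℝ
  p_nonneg : ∀ i, 0 ≤ p i
  p_sum : ∑ i, p i = 1

namespace MIR

variable {n m : ℕ} (A : MIR n m)

/-- A user of type `i` is satisfied by the displayed results `X`. -/
def Satisfied (i : Fin m) (X : List (Fin n)) : Prop := A.K i ≤ (X.toFinset ∩ A.S i).card

/-- The tree satisfies every user-type. -/
def Feasible (T : DecisionTree (Fin n)) : Prop :=
  ∀ i, A.Satisfied i (T.path (A.S i))

/-- The number of results that are displayed until a user of type `i` is satisfied
(meaningful if `T` satisfies the type `i`). -/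
def numResults (T : DecisionTree (Fin n)) (i : Fin m) : ℕ :=
  sInf {k : ℕ | A.Satisfied i ((T.path (A.S i)).take k)}

/-- The expected number of results until the random user is satisfied. -/
def expectedCost (T : DecisionTree (Fin n)) : ℝ := ∑ i, A.p i * (A.numResults T i : ℝ)

/-- The largest threshold. -/
def maxK : ℕ := Finset.univ.sup A.K

/-- The model as adaptive submodular ranking, with unit costs and
`f i X = min (|X ∩ S i|, K i) / K i`. -/
def toASR : ASR n m where
  c := fun _ => 1
  c_pos := fun _ => one_pos
  S := A.S
  f := fun i X => (min (X ∩ A.S i).card (A.K i) : ℕ) / (A.K i : ℝ)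
  f_inter := by
    intro i X
    simp only [Finset.inter_assoc, Finset.inter_self]
  f_empty := by
    intro i
    simp
  f_full := by
    intro i
    have h1 : (A.K i : ℝ) ≠ 0 := by
      have := A.K_pos i
      exact_mod_cast (by omega : A.K i ≠ 0)
    rw [Finset.inter_self, min_eq_right (A.K_le i), div_self h1]
  f_mono := by
    intro i X Y h
    have h1 : (X ∩ A.S i).card ≤ (Y ∩ A.S i).card :=
      Finset.card_le_card (Finset.inter_subset_inter_right h)
    gcongr
  f_submodular := by
    intro i X Y
    rw [← add_div, ← add_div]
    have h1 := Finset.card_union_add_card_inter (X ∩ A.S i) (Y ∩ A.S i)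
    rw [← Finset.union_inter_distrib_right, ← Finset.inter_inter_distrib_right] at h1
    have h2 : ((X ∩ Y) ∩ A.S i).card ≤ (X ∩ A.S i).card :=
      Finset.card_le_card (Finset.inter_subset_inter_right Finset.inter_subset_left)
    have h3 : ((X ∩ Y) ∩ A.S i).card ≤ (Y ∩ A.S i).card :=
      Finset.card_le_card (Finset.inter_subset_inter_right Finset.inter_subset_right)
    have h4 : min ((X ∩ Y) ∩ A.S i).card (A.K i) + min ((X ∪ Y) ∩ A.S i).card (A.K i)
        ≤ min (X ∩ A.S i).card (A.K i) + min (Y ∩ A.S i).card (A.K i) := by omega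
    apply div_le_div_of_nonneg_right _ (Nat.cast_nonneg _)
    exact_mod_cast h4
  p := A.p
  p_nonneg := A.p_nonneg
  p_sum := A.p_sum

open Timed in
/-- Evaluates `min (|X ∩ S i|, K i) / K i` for a list `X` of distinct results. -/
def oracle (i : Fin m) (X : List (Fin n)) : Timed ℝ := do
  let Y ← Timed.filter (fun e => tick (decide (e ∈ A.S i))) X
  let y ← Timed.length Y
  let k ← tick (A.K i)
  let z ← tick (min y k)
  tick ((z : ℝ) / (k : ℝ))

/-- The greedy algorithm for adaptive multiple intent ranking. -/
def algorithm : Timed (DecisionTree (Fin n)) := A.toASR.greedyProgram A.oracle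

end MIR

end AdaptiveRanking

end

/-! Why the approximation bound holds. Let `a t` be the probability mass that the greedy tree has
not satisfied after `t` results, `x τ` the same quantity for a competing feasible tree `T₀`, and `s
t` the sum of the scores of the greedy nodes at depth `t`. The two expected costs are `∑ a` and `∑
x`, and two inequalities link the three sequences.

Lower bound on the scores: at a greedy state `(E, H)`, following the majority branches of `T₀` for
`τ` steps gives a single list `Q`. A type of `H` that `T₀` satisfies within `τ` steps either falls
into a minority part along `Q` or is satisfied by `Q` itself; in both cases, by submodularity in the
second, its contributions to the scores of the undisplayed results of `Q` add up to at least 1.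
Since greedy maximizes the score, `a t ≤ τ * s t + x τ` follows (`mass_le_mul_score_add`, summed
over a depth in `IsGreedy.exists_charging`).

Upper bound on the scores: the potential `log₂ |H| + 1 + log ((1 - f_i(E)) / ε)` pays for all later
contributions of type `i` (`gain_add_potential_le`, `gain_le_potential`). With `ε = 1 / max K` it
starts at `B = log₂ m + 1 + log (max K)`, so the scores from time `t₀` on sum to at most `B * a t₀`.

The double counting of `sum_le_four_mul_sum` turns these into `∑ a ≤ 4 * B * ∑ x`.

The running time is polynomial because the type lists at nodes of equal depth are disjoint, which
leaves at most `n * m` internal nodes, each handled in polynomial time. -/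

namespace AdaptiveRanking

/-! ### Double counting of unsatisfied mass -/

/-- Comparison of two tail-mass sequences by double counting: if `a t ≤ τ * s t + x τ` for all
times and the tails of `s` are bounded by `B * a`, then `∑ a ≤ 4 * B * ∑ x`. -/
theorem sum_le_four_mul_sum {a s x : ℕ → ℝ} {B : ℝ} {N : ℕ} (hB : 0 ≤ B)
    (ha : ∀ t, 0 ≤ a t) (hs : ∀ t, 0 ≤ s t) (hx : ∀ t, 0 ≤ x t)
    (hxN : x N = 0) (hle : ∀ t τ : ℕ, a t ≤ τ * s t + x τ)
    (htail : ∀ t₀, ∑ t ∈ Finset.Ico t₀ N, s t ≤ B * a t₀) :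
    ∑ t ∈ Finset.range N, a t ≤ 4 * B * ∑ σ ∈ Finset.range N, x σ := by
  classical
  have h1 : ∀ t, a t ≤ ∑ σ ∈ Finset.range N, (if a t < 2 * x σ then 2 * s t else 0) := by
    intro t
    -- For the least such `τ`, half of `a t` absorbs `x τ`, so `a t ≤ τ * (2 * s t)`; each of the
    -- `τ` smaller indices `σ` satisfies `a t < 2 * x σ` and hosts one copy of `2 * s t`.
    have hex : ∃ τ, 2 * x τ ≤ a t := ⟨N, by rw [hxN]; simpa using ha t⟩
    have hτ := Nat.find_spec hex
    have hmin : ∀ σ < Nat.find hex, a t < 2 * x σ := fun σ hσ =>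
      not_le.mp (Nat.find_min hex hσ)
    have hN : Nat.find hex ≤ N := Nat.find_min' hex (by rw [hxN]; simpa using ha t)
    have hsub : Finset.range (Nat.find hex) ⊆
        (Finset.range N).filter (fun σ => a t < 2 * x σ) := by
      intro σ hσ
      rw [Finset.mem_range] at hσ
      exact Finset.mem_filter.mpr ⟨Finset.mem_range.mpr (hσ.trans_le hN), hmin σ hσ⟩
    have hcard := Finset.card_le_card hsub
    rw [Finset.card_range] at hcard
    rw [← Finset.sum_filter, Finset.sum_const, nsmul_eq_mul]
    have h2 : (Nat.find hex : ℝ) * (2 * s t) ≤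
        (((Finset.range N).filter (fun σ => a t < 2 * x σ)).card : ℝ) * (2 * s t) :=
      mul_le_mul_of_nonneg_right (by exact_mod_cast hcard) (by linarith [hs t])
    have h3 := hle t (Nat.find hex)
    linarith
  have h2 : ∀ σ, ∑ t ∈ Finset.range N, (if a t < 2 * x σ then 2 * s t else 0) ≤
      4 * B * x σ := by
    intro σ
    rw [← Finset.sum_filter]
    rcases ((Finset.range N).filter (fun t => a t < 2 * x σ)).eq_empty_or_nonempty with h | h
    · rw [h, Finset.sum_empty]
      have := mul_nonneg hB (hx σ)
      linarith
    -- The times charged to `σ` lie in the tail from the earliest one, `t₀`, where `a t₀ < 2 * x σ`;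
    -- monotonicity of `a` is not needed.
    · obtain ⟨t₀, ht₀, hmin⟩ := Finset.exists_min_image _ id h
      have hsub : (Finset.range N).filter (fun t => a t < 2 * x σ) ⊆ Finset.Ico t₀ N := by
        intro t ht
        exact Finset.mem_Ico.mpr
          ⟨hmin t ht, Finset.mem_range.mp (Finset.mem_filter.mp ht).1⟩
      have h3 := Finset.sum_le_sum_of_subset_of_nonneg hsub (f := fun t => 2 * s t)
        (fun t _ _ => by linarith [hs t])
      rw [← Finset.mul_sum (Finset.Ico t₀ N)] at h3
      have h4 := htail t₀
      have h5 : B * a t₀ ≤ B * (2 * x σ) :=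
        mul_le_mul_of_nonneg_left (Finset.mem_filter.mp ht₀).2.le hB
      linarith
  calc ∑ t ∈ Finset.range N, a t
      ≤ ∑ t ∈ Finset.range N, ∑ σ ∈ Finset.range N,
          (if a t < 2 * x σ then 2 * s t else 0) := Finset.sum_le_sum fun t _ => h1 t
    _ = ∑ σ ∈ Finset.range N, ∑ t ∈ Finset.range N,
          (if a t < 2 * x σ then 2 * s t else 0) := Finset.sum_comm
    _ ≤ ∑ σ ∈ Finset.range N, 4 * B * x σ := Finset.sum_le_sum fun σ _ => h2 σ
    _ = _ := by rw [Finset.mul_sum]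

/-! ### Greedy score versus the progress of another tree -/

namespace ASR

variable {n m : ℕ} (A : ASR n m)

/-- The elements met on the way through a tree when the majority branch is taken at every node. -/
theorem exists_stem {H : Finset (Fin m)} {L : Fin n → Finset (Fin m)}
    (hL : ∀ a, A.IsMinorityPart H a (L a)) (T : DecisionTree (Fin n)) (τ : ℕ) :
    ∃ Q : List (Fin n), Q.length ≤ τ ∧
      ∀ i ∈ H, (∃ e ∈ Q, i ∈ L e) ∨ (T.path (A.S i)).take τ = Q := by
  induction T generalizing τ with
  | leaf => exact ⟨[], by simp, fun i _ => Or.inr (by simp [DecisionTree.path])⟩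
  | node e yes no ihy ihn =>
    cases τ with
    | zero => exact ⟨[], by simp, fun i _ => Or.inr (by simp)⟩
    | succ τ =>
      -- If the minority part is the yes-part, the stem continues into `no`, and conversely.
      rcases hL e with h | h
      · obtain ⟨Q, hQ, hQ'⟩ := ihn τ
        refine ⟨e :: Q, by simpa using hQ, fun i hi => ?_⟩
        by_cases hie : e ∈ A.S i
        · exact Or.inl ⟨e, by simp, by rw [h.1]; simp [hi, hie]⟩
        · rcases hQ' i hi with ⟨b, hb, hb'⟩ | h'
          · exact Or.inl ⟨b, by simp [hb], hb'⟩
          · exact Or.inr (by simp [DecisionTree.path, hie, h'])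
      · obtain ⟨Q, hQ, hQ'⟩ := ihy τ
        refine ⟨e :: Q, by simpa using hQ, fun i hi => ?_⟩
        by_cases hie : e ∈ A.S i
        · rcases hQ' i hi with ⟨b, hb, hb'⟩ | h'
          · exact Or.inl ⟨b, by simp [hb], hb'⟩
          · exact Or.inr (by simp [DecisionTree.path, hie, h'])
        · exact Or.inl ⟨e, by simp, by rw [h.1]; simp [hi, hie]⟩

/-- Adding the elements of `Q` one by one, each marginal increment is at most the one over `E`, by
submodularity for `E ∪ Q` and `insert e E`. -/
theorem f_union_sub_le_sum (i : Fin m) (E Q : Finset (Fin n)) :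
    A.f i (E ∪ Q) - A.f i E ≤ ∑ e ∈ Q, (A.f i (insert e E) - A.f i E) := by
  induction Q using Finset.induction_on with
  | empty => simp
  | insert e Q he ih =>
    rw [Finset.sum_insert he]
    have h1 := A.f_submodular i (E ∪ Q) (insert e E)
    have h2 : (E ∪ Q) ∪ insert e E = E ∪ insert e Q := by
      ext b; simp only [Finset.mem_union, Finset.mem_insert]; tauto
    have h3 := A.f_mono i E ((E ∪ Q) ∩ insert e E) (by
      intro b hb; simp [hb])
    rw [h2] at h1
    linarith

/-- The contribution of the scenario `i` to the score of `e`, per unit of probability. -/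
noncomputable def gain (E : Finset (Fin n)) (L : Finset (Fin m)) (e : Fin n) (i : Fin m) : ℝ :=
  (if i ∈ L then 1 else 0) + (A.f i (insert e E) - A.f i E) / (1 - A.f i E)

variable {A}

theorem IsMinorityPart.subset {H L : Finset (Fin m)} {e : Fin n} (h : A.IsMinorityPart H e L) :
    L ⊆ H := by
  rcases h with h | h <;> rw [h.1] <;> exact Finset.filter_subset _ _

theorem score_eq_sum_gain (hc : ∀ e, A.c e = 1) {E : Finset (Fin n)} {H L : Finset (Fin m)}
    (hL : L ⊆ H) (e : Fin n) : A.score E H L e = ∑ i ∈ H, A.p i * A.gain E L e i := by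
  simp only [score, gain, hc, mul_add, Finset.sum_add_distrib, mul_ite, mul_one, mul_zero]
  rw [Finset.sum_ite_mem, Finset.inter_eq_right.mpr hL]
  simp

theorem gain_nonneg {E : Finset (Fin n)} {i : Fin m} (hi : A.f i E < 1)
    (L : Finset (Fin m)) (e : Fin n) : 0 ≤ A.gain E L e i := by
  have h1 := A.f_mono i E (insert e E) (Finset.subset_insert _ _)
  unfold gain
  have : 0 ≤ (A.f i (insert e E) - A.f i E) / (1 - A.f i E) :=
    div_nonneg (by linarith) (by linarith)
  split_ifs <;> linarith

/-- The mass of the current scenarios that a tree covers within `τ` steps is at most `τ` times the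
greedy score. -/
theorem mass_le_mul_score_add (hc : ∀ e, A.c e = 1) {E : Finset (Fin n)} {H : Finset (Fin m)}
    (hcov : ∀ i ∈ H, A.f i E < 1)
    (hcomp : ∀ e ∈ E, ∀ i ∈ H, ∀ j ∈ H, e ∈ A.S i ↔ e ∈ A.S j)
    {L : Fin n → Finset (Fin m)} (hL : ∀ a, A.IsMinorityPart H a (L a)) {M : ℝ} (hM : 0 ≤ M)
    (hmax : ∀ a, a ∉ E → A.score E H (L a) a ≤ M) (T : DecisionTree (Fin n)) (τ : ℕ) :
    ∑ i ∈ H, A.p i ≤ τ * M +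
      ∑ i ∈ H with A.f i ((T.path (A.S i)).take τ).toFinset < 1, A.p i := by
  classical
  obtain ⟨Q, hQ, hQ'⟩ := A.exists_stem hL T τ
  -- All of `H` gave the same answer on a displayed element, so its minority part is empty.
  have hLE : ∀ e, ∀ i ∈ L e, e ∉ E := by
    intro e i hi he
    have hiH := (hL e).subset hi
    have key : ∀ j ∈ H, (e ∈ A.S j ↔ e ∈ A.S i) := fun j hj => hcomp e he j hj i hiH
    have hpos : 0 < H.card := Finset.card_pos.mpr ⟨i, hiH⟩
    rcases hL e with h | h <;> rw [h.1, Finset.mem_filter] at hi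
    · have h1 : H.filter (fun i => e ∈ A.S i) = H :=
        Finset.filter_true_of_mem fun j hj => (key j hj).mpr hi.2
      have h2 : H.filter (fun i => e ∉ A.S i) = ∅ :=
        Finset.filter_false_of_mem fun j hj => not_not.mpr ((key j hj).mpr hi.2)
      have := h.2
      rw [h1, h2, Finset.card_empty] at this
      omega
    · have h1 : H.filter (fun i => e ∈ A.S i) = ∅ :=
        Finset.filter_false_of_mem fun j hj => fun hh => hi.2 ((key j hj).mp hh)
      have h2 : H.filter (fun i => e ∉ A.S i) = H :=
        Finset.filter_true_of_mem fun j hj => fun hh => hi.2 ((key j hj).mp hh)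
      have := h.2
      rw [h1, h2, Finset.card_empty] at this
      omega
  -- Greedy optimality only speaks of undisplayed elements; by `hLE` the displayed ones separate
  -- nothing, and they add nothing to `f` over `E`.
  set R := Q.toFinset \ E with hR
  have hone : ∀ i ∈ H, 1 ≤ ∑ e ∈ R, A.gain E (L e) e i +
      (if A.f i ((T.path (A.S i)).take τ).toFinset < 1 then 1 else 0) := by
    intro i hi
    have hnn : ∀ e ∈ R, 0 ≤ A.gain E (L e) e i := fun e _ => gain_nonneg (hcov i hi) _ _
    have hsn := Finset.sum_nonneg hnn
    split_ifs with hlt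
    · linarith
    rw [add_zero]
    -- A type that leaves the stem gains 1 from the minority term at that element; a type that stays
    -- has prefix `Q`, so the increments over `R` add up to at least `1 - A.f i E`.
    rcases hQ' i hi with ⟨e, he, hie⟩ | h
    · have heR : e ∈ R := by simp [hR, he, hLE e i hie]
      refine le_trans ?_ (Finset.single_le_sum hnn heR)
      have h1 := A.f_mono i E (insert e E) (Finset.subset_insert _ _)
      have h2 := hcov i hi
      have : 0 ≤ (A.f i (insert e E) - A.f i E) / (1 - A.f i E) :=
        div_nonneg (by linarith) (by linarith)
      simp only [gain, hie, if_true]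
      linarith
    · rw [h, not_lt] at hlt
      have h2 := hcov i hi
      have h3 := A.f_union_sub_le_sum i E R
      have h4 := A.f_mono i Q.toFinset (E ∪ R) (by
        rw [hR, Finset.union_sdiff_self_eq_union]; exact Finset.subset_union_right)
      calc (1 : ℝ) = (1 - A.f i E) / (1 - A.f i E) := (div_self (by linarith)).symm
        _ ≤ (∑ e ∈ R, (A.f i (insert e E) - A.f i E)) / (1 - A.f i E) :=
          div_le_div_of_nonneg_right (by linarith) (by linarith)
        _ = ∑ e ∈ R, (A.f i (insert e E) - A.f i E) / (1 - A.f i E) := Finset.sum_div _ _ _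
        _ ≤ ∑ e ∈ R, A.gain E (L e) e i := Finset.sum_le_sum fun e _ => by
          unfold gain; split_ifs <;> linarith
  have hcardR : (R.card : ℝ) ≤ τ := by
    have h1 : R.card ≤ Q.toFinset.card := Finset.card_le_card Finset.sdiff_subset
    have h2 := Q.toFinset_card_le
    exact_mod_cast h1.trans (h2.trans hQ)
  calc ∑ i ∈ H, A.p i
      ≤ ∑ i ∈ H, A.p i * (∑ e ∈ R, A.gain E (L e) e i +
          (if A.f i ((T.path (A.S i)).take τ).toFinset < 1 then 1 else 0)) :=
        Finset.sum_le_sum fun i hi => le_mul_of_one_le_right (A.p_nonneg i) (hone i hi)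
    _ = ∑ e ∈ R, A.score E H (L e) e +
          ∑ i ∈ H with A.f i ((T.path (A.S i)).take τ).toFinset < 1, A.p i := by
        simp only [mul_add, Finset.sum_add_distrib, mul_ite, mul_one, mul_zero, Finset.mul_sum]
        rw [Finset.sum_comm, Finset.sum_filter]
        congr 1
        exact Finset.sum_congr rfl fun e _ => (score_eq_sum_gain hc (hL e).subset e).symm
    _ ≤ _ := by
        have h1 : ∑ e ∈ R, A.score E H (L e) e ≤ R.card * M := by
          rw [← nsmul_eq_mul]
          exact Finset.sum_le_card_nsmul _ _ _ fun e he =>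
            hmax e (Finset.mem_sdiff.mp he).2
        have h2 := mul_le_mul_of_nonneg_right hcardR hM
        linarith

/-! ### The potential of a scenario -/

theorem two_mul_card_minorityPart_le {H L : Finset (Fin m)} {e : Fin n}
    (h : A.IsMinorityPart H e L) : 2 * L.card ≤ H.card := by
  have h1 := Finset.card_filter_add_card_filter_not (s := H) (fun i => e ∈ A.S i)
  rcases h with h | h <;> rw [h.1] <;> have := h.2 <;> omega

/-- The potential of a scenario pays for its contribution to the current score. -/
theorem gain_add_potential_le {ε : ℝ} (hε : 0 < ε)
    {E : Finset (Fin n)} {H H' L : Finset (Fin m)} {e : Fin n} {i : Fin m}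
    (hi : A.f i (insert e E) < 1) (hiH : i ∈ H') (hH' : H' ⊆ H)
    (hL : 2 * L.card ≤ H.card) (hiL : i ∈ L → H' ⊆ L) :
    A.gain E L e i + (Real.logb 2 H'.card + 1 + Real.log ((1 - A.f i (insert e E)) / ε)) ≤
      Real.logb 2 H.card + 1 + Real.log ((1 - A.f i E) / ε) := by
  have h1 := A.f_mono i E (insert e E) (Finset.subset_insert _ _)
  have hpos : (0 : ℝ) < H'.card := by exact_mod_cast Finset.card_pos.mpr ⟨i, hiH⟩
  have ha : (0 : ℝ) < 1 - A.f i (insert e E) := by linarith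
  have hb : (0 : ℝ) < 1 - A.f i E := by linarith
  -- With residuals `b = 1 - A.f i E` and `a = 1 - A.f i (insert e E)` this is `1 - a / b ≤ log (b /
  -- a)`.
  have h2 : (A.f i (insert e E) - A.f i E) / (1 - A.f i E) ≤
      Real.log (1 - A.f i E) - Real.log (1 - A.f i (insert e E)) := by
    have h3 := Real.one_sub_inv_le_log_of_pos (div_pos hb ha)
    rw [Real.log_div hb.ne' ha.ne', inv_div] at h3
    refine le_trans (le_of_eq ?_) h3
    field_simp
    ring
  -- Landing in the minority part at least halves the surviving set, which costs one unit of `logb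
  -- 2`.
  have h4 : (if i ∈ L then (1 : ℝ) else 0) ≤ Real.logb 2 H.card - Real.logb 2 H'.card := by
    split_ifs with h
    · have h5 := Finset.card_le_card (hiL h)
      have h6 : 2 * H'.card ≤ H.card := by omega
      have h7 : (2 : ℝ) * H'.card ≤ H.card := by exact_mod_cast h6
      have h8 := Real.logb_le_logb_of_le (b := 2) (by norm_num) (by positivity) h7
      rw [Real.logb_mul (by norm_num) hpos.ne',
        Real.logb_self_eq_one (by norm_num)] at h8
      linarith
    · have h7 : (H'.card : ℝ) ≤ H.card := by exact_mod_cast Finset.card_le_card hH'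
      have h8 := Real.logb_le_logb_of_le (b := 2) (by norm_num) hpos h7
      linarith
  rw [Real.log_div ha.ne' hε.ne', Real.log_div hb.ne' hε.ne']
  unfold gain
  linarith

variable (A) in
theorem f_le_one (i : Fin m) (X : Finset (Fin n)) : A.f i X ≤ 1 := by
  rw [A.f_inter, ← A.f_full i]
  exact A.f_mono i _ _ Finset.inter_subset_right

/-- Needed for the step that covers `i`, after which no potential is left: the summand 1 pays for
the fractional term, and membership in `L` forces `2 ≤ H.card`, so that `logb 2 H.card` pays for the
minority term. -/
theorem gain_le_potential {ε : ℝ} (hε : 0 < ε) {E : Finset (Fin n)} {H L : Finset (Fin m)}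
    {e : Fin n} {i : Fin m} (hiε : ∀ X, A.f i X < 1 → ε ≤ 1 - A.f i X)
    (hi : A.f i E < 1) (hiH : i ∈ H) (hL : 2 * L.card ≤ H.card) :
    A.gain E L e i ≤ Real.logb 2 H.card + 1 + Real.log ((1 - A.f i E) / ε) := by
  have h1 : 0 ≤ Real.log ((1 - A.f i E) / ε) :=
    Real.log_nonneg ((one_le_div hε).mpr (hiε E hi))
  have h2 : (A.f i (insert e E) - A.f i E) / (1 - A.f i E) ≤ 1 :=
    (div_le_one (by linarith)).mpr (by linarith [A.f_le_one i (insert e E)])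
  have h3 : (if i ∈ L then (1 : ℝ) else 0) ≤ Real.logb 2 H.card := by
    split_ifs with h
    · have h4 : 0 < L.card := Finset.card_pos.mpr ⟨i, h⟩
      have h5 : (2 : ℝ) ≤ H.card := by exact_mod_cast (by omega : 2 ≤ H.card)
      have h6 := Real.logb_le_logb_of_le (b := 2) (by norm_num) (by norm_num) h5
      rwa [Real.logb_self_eq_one (by norm_num)] at h6
    · have h4 : 0 < H.card := Finset.card_pos.mpr ⟨i, hiH⟩
      exact Real.logb_nonneg (by norm_num) (by exact_mod_cast h4)
  unfold gain
  linarith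

end ASR
end AdaptiveRanking

/-! ### Charging along the greedy tree -/

namespace AdaptiveRanking
namespace ASR

variable {n m : ℕ} {A : ASR n m}

/-- Scenarios covered by `e` enter neither branch, whence the vanishing condition on `g`. -/
theorem sum_eq_sum_branches {H : Finset (Fin m)} {E : Finset (Fin n)} (e : Fin n)
    (g : Fin m → ℝ) (hg : ∀ i ∈ H, ¬ A.f i (insert e E) < 1 → g i = 0) :
    ∑ i ∈ H, g i = ∑ i ∈ H with e ∈ A.S i ∧ A.f i (insert e E) < 1, g i +
      ∑ i ∈ H with e ∉ A.S i ∧ A.f i (insert e E) < 1, g i := by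
  rw [Finset.sum_filter, Finset.sum_filter, ← Finset.sum_add_distrib]
  refine Finset.sum_congr rfl fun i hi => ?_
  have := hg i hi
  by_cases h1 : e ∈ A.S i <;> by_cases h2 : A.f i (insert e E) < 1 <;> simp_all

theorem union_path_node_yes {S : Finset (Fin n)} {e : Fin n} (he : e ∈ S) (E : Finset (Fin n))
    (yes no : DecisionTree (Fin n)) (t : ℕ) :
    E ∪ (((DecisionTree.node e yes no).path S).take (t + 1)).toFinset =
      insert e E ∪ ((yes.path S).take t).toFinset := by
  simp [DecisionTree.path, he]

theorem union_path_node_no {S : Finset (Fin n)} {e : Fin n} (he : e ∉ S) (E : Finset (Fin n))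
    (yes no : DecisionTree (Fin n)) (t : ℕ) :
    E ∪ (((DecisionTree.node e yes no).path S).take (t + 1)).toFinset =
      insert e E ∪ ((no.path S).take t).toFinset := by
  simp [DecisionTree.path, he]

theorem not_lt_of_not_lt_insert {i : Fin m} {e : Fin n} {E : Finset (Fin n)}
    (h : ¬ A.f i (insert e E) < 1) (yes no : DecisionTree (Fin n)) (t : ℕ) :
    ¬ A.f i (E ∪ (((DecisionTree.node e yes no).path (A.S i)).take (t + 1)).toFinset) < 1 := by
  rw [not_lt] at h ⊢
  refine h.trans (A.f_mono _ _ _ ?_)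
  by_cases he : e ∈ A.S i
  · rw [union_path_node_yes he]; exact Finset.subset_union_left
  · rw [union_path_node_no he]; exact Finset.subset_union_left

theorem IsGreedy.covers {E : Finset (Fin n)} {H : Finset (Fin m)} {T : DecisionTree (Fin n)}
    (h : A.IsGreedy E H T) : ∀ i ∈ H, 1 ≤ A.f i (E ∪ (T.path (A.S i)).toFinset) := by
  induction h with
  | finished E => simp
  | step E H hH L hL e he hmax yes no _ _ ihy ihn =>
    intro i hi
    by_cases hlt : A.f i (insert e E) < 1
    · by_cases hie : e ∈ A.S i
      · have := ihy i (by simp [hi, hie, hlt])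
        simpa [DecisionTree.path, hie] using this
      · have := ihn i (by simp [hi, hie, hlt])
        simpa [DecisionTree.path, hie] using this
    · refine (not_lt.mp hlt).trans (A.f_mono _ _ _ ?_)
      intro b hb
      simp only [Finset.mem_insert, DecisionTree.path, Finset.mem_union, List.mem_toFinset,
        List.mem_cons] at hb ⊢
      tauto

/-- A greedy tree distributes the scores of its nodes to the scenarios in such a way that every
scenario receives a bounded amount, while the total amount at each time is large compared with the
mass that another tree covers. -/
theorem IsGreedy.exists_charging (hc : ∀ e, A.c e = 1) {ε : ℝ} (hε : 0 < ε)
    (hAε : ∀ i X, A.f i X < 1 → ε ≤ 1 - A.f i X) (T₀ : DecisionTree (Fin n))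
    {E : Finset (Fin n)} {H : Finset (Fin m)} {T : DecisionTree (Fin n)}
    (h : A.IsGreedy E H T) (hcov : ∀ i ∈ H, A.f i E < 1)
    (hcomp : ∀ e ∈ E, ∀ i ∈ H, ∀ j ∈ H, e ∈ A.S i ↔ e ∈ A.S j) :
    ∃ s : Fin m → ℕ → ℝ, (∀ i t, 0 ≤ s i t) ∧
      (∀ i ∈ H, ∀ t,
        ¬ A.f i (E ∪ ((T.path (A.S i)).take t).toFinset) < 1 → s i t = 0) ∧
      (∀ i ∈ H, ∀ N, ∑ t ∈ Finset.range N, s i t ≤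
        Real.logb 2 H.card + 1 + Real.log ((1 - A.f i E) / ε)) ∧
      ∀ t τ : ℕ,
        ∑ i ∈ H, (if A.f i (E ∪ ((T.path (A.S i)).take t).toFinset) < 1 then A.p i else 0) ≤
          τ * ∑ i ∈ H, A.p i * s i t +
          ∑ i ∈ H, (if A.f i (E ∪ ((T.path (A.S i)).take t).toFinset) < 1 ∧
            A.f i ((T₀.path (A.S i)).take τ).toFinset < 1 then A.p i else 0) := by
  classical
  induction h with
  | finished E => exact ⟨fun _ _ => 0, by simp⟩
  | step E H hH L hL e he hmax yes no _ _ ihy ihn =>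
    set Hy := H.filter (fun i => e ∈ A.S i ∧ A.f i (insert e E) < 1) with hHy
    set Hn := H.filter (fun i => e ∉ A.S i ∧ A.f i (insert e E) < 1) with hHn
    obtain ⟨sy, hy1, hy2, hy3, hy4⟩ := ihy (fun i hi => (Finset.mem_filter.mp hi).2.2) (by
      intro a ha i hi j hj
      rw [hHy, Finset.mem_filter] at hi hj
      rcases Finset.mem_insert.mp ha with rfl | ha
      · exact iff_of_true hi.2.1 hj.2.1
      · exact hcomp a ha i hi.1 j hj.1)
    obtain ⟨sn, hn1, hn2, hn3, hn4⟩ := ihn (fun i hi => (Finset.mem_filter.mp hi).2.2) (by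
      intro a ha i hi j hj
      rw [hHn, Finset.mem_filter] at hi hj
      rcases Finset.mem_insert.mp ha with rfl | ha
      · exact iff_of_false hi.2.1 hj.2.1
      · exact hcomp a ha i hi.1 j hj.1)
    have hL2 := two_mul_card_minorityPart_le (hL e)
    have hscore := score_eq_sum_gain hc (hL e).subset (E := E) e
    have hdisj : ∀ i ∈ Hn, i ∉ Hy := fun i hi hi' =>
      (Finset.mem_filter.mp hi).2.1 (Finset.mem_filter.mp hi').2.1
    -- The charge at time 0 is the gain at the root; later charges are those of the child that `i`
    -- enters, shifted by one, and 0 once `i` is covered.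
    let s : Fin m → ℕ → ℝ := fun i t => match t with
      | 0 => if i ∈ H then A.gain E (L e) e i else 0
      | t + 1 => if i ∈ Hy then sy i t else if i ∈ Hn then sn i t else 0
    have hsy : ∀ i ∈ Hy, ∀ t, s i (t + 1) = sy i t := fun i hi t => if_pos hi
    have hsn : ∀ i ∈ Hn, ∀ t, s i (t + 1) = sn i t := fun i hi t =>
      (if_neg (hdisj i hi)).trans (if_pos hi)
    have hs0 : ∀ i ∈ H, s i 0 = A.gain E (L e) e i := fun i hi => if_pos hi
    have hnot : ∀ i, ¬ A.f i (insert e E) < 1 → ∀ t, s i (t + 1) = 0 := fun i hi t =>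
      (if_neg fun h => hi (Finset.mem_filter.mp h).2.2).trans
        (if_neg fun h => hi (Finset.mem_filter.mp h).2.2)
    have hcases : ∀ i ∈ H, A.f i (insert e E) < 1 → i ∈ Hy ∨ i ∈ Hn := by
      intro i hi hlt
      by_cases hie : e ∈ A.S i
      · exact Or.inl (Finset.mem_filter.mpr ⟨hi, hie, hlt⟩)
      · exact Or.inr (Finset.mem_filter.mpr ⟨hi, hie, hlt⟩)
    have hyU : ∀ i ∈ Hy, ∀ t, E ∪ (((DecisionTree.node e yes no).path (A.S i)).take
        (t + 1)).toFinset = insert e E ∪ ((yes.path (A.S i)).take t).toFinset := fun i hi t =>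
      union_path_node_yes (Finset.mem_filter.mp hi).2.1 _ _ _ _
    have hnU : ∀ i ∈ Hn, ∀ t, E ∪ (((DecisionTree.node e yes no).path (A.S i)).take
        (t + 1)).toFinset = insert e E ∪ ((no.path (A.S i)).take t).toFinset := fun i hi t =>
      union_path_node_no (Finset.mem_filter.mp hi).2.1 _ _ _ _
    refine ⟨s, ?_, ?_, ?_, ?_⟩
    · intro i t
      cases t with
      | zero =>
        show 0 ≤ if i ∈ H then A.gain E (L e) e i else 0
        split_ifs with hi
        · exact gain_nonneg (hcov i hi) _ _
        · exact le_rfl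
      | succ t =>
        show 0 ≤ if i ∈ Hy then sy i t else if i ∈ Hn then sn i t else 0
        split_ifs
        · exact hy1 i t
        · exact hn1 i t
        · exact le_rfl
    · intro i hi t ht
      cases t with
      | zero => exact absurd (by simpa using hcov i hi) ht
      | succ t =>
        by_cases hlt : A.f i (insert e E) < 1
        · rcases hcases i hi hlt with h | h
          · rw [hsy i h]
            rw [hyU i h] at ht
            exact hy2 i h t ht
          · rw [hsn i h]
            rw [hnU i h] at ht
            exact hn2 i h t ht
        · exact hnot i hlt t
    · intro i hi N
      have hbase := gain_le_potential (L := L e) (e := e) hε (hAε i) (hcov i hi) hi hL2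
      cases N with
      | zero =>
        rw [Finset.sum_range_zero]
        exact (gain_nonneg (hcov i hi) _ _).trans hbase
      | succ N =>
        rw [Finset.sum_range_succ', hs0 i hi]
        by_cases hlt : A.f i (insert e E) < 1
        · rcases hcases i hi hlt with h | h
          · rw [Finset.sum_congr rfl fun t _ => hsy i h t, add_comm]
            refine le_trans (add_le_add_right (hy3 i h N) _)
              (gain_add_potential_le hε hlt h (Finset.filter_subset _ _) hL2 fun hiL => ?_)
            -- If `i` takes the yes-branch and lies in `L e`, then `L e` is the yes-part and
            -- contains all survivors of that branch.
            intro j hj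
            rw [hHy, Finset.mem_filter] at h hj
            rcases hL e with hl | hl <;> rw [hl.1, Finset.mem_filter] at hiL ⊢
            · exact ⟨hj.1, hj.2.1⟩
            · exact absurd h.2.1 hiL.2
          · rw [Finset.sum_congr rfl fun t _ => hsn i h t, add_comm]
            refine le_trans (add_le_add_right (hn3 i h N) _)
              (gain_add_potential_le hε hlt h (Finset.filter_subset _ _) hL2 fun hiL => ?_)
            intro j hj
            rw [hHn, Finset.mem_filter] at h hj
            rcases hL e with hl | hl <;> rw [hl.1, Finset.mem_filter] at hiL ⊢
            · exact absurd hiL.2 h.2.1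
            · exact ⟨hj.1, hj.2.1⟩
        · rw [Finset.sum_congr rfl fun t _ => hnot i hlt t, Finset.sum_const_zero, zero_add]
          exact hbase
    · intro t τ
      cases t with
      | zero =>
        have h0 : ∀ i ∈ H, A.f i (E ∪ (((DecisionTree.node e yes no).path (A.S i)).take
            0).toFinset) < 1 := fun i hi => by simpa using hcov i hi
        rw [Finset.sum_congr rfl fun i hi => if_pos (h0 i hi),
          Finset.sum_congr rfl fun i hi => congrArg (A.p i * ·) (hs0 i hi), ← hscore]
        have hM : 0 ≤ A.score E H (L e) e := by
          rw [hscore]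
          exact Finset.sum_nonneg fun i hi =>
            mul_nonneg (A.p_nonneg i) (gain_nonneg (hcov i hi) _ _)
        -- At time 0 all of `H` is uncovered and the total charge is the score of the root.
        refine (mass_le_mul_score_add hc hcov hcomp hL hM hmax T₀ τ).trans (le_of_eq ?_)
        congr 1
        rw [Finset.sum_filter]
        refine Finset.sum_congr rfl fun i hi => ?_
        simp only [h0 i hi, true_and]
      | succ t =>
        -- At time `t + 1` the claim is the sum of the children's claims at time `t`, with the same
        -- `τ`.
        rw [sum_eq_sum_branches (A := A) (E := E) e _ fun i _ hlt =>
            if_neg (not_lt_of_not_lt_insert hlt yes no t),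
          sum_eq_sum_branches (A := A) (E := E) e (fun i => A.p i * s i (t + 1))
            fun i _ hlt => by rw [hnot i hlt, mul_zero],
          sum_eq_sum_branches (A := A) (E := E) e (fun i => if _ ∧ _ then A.p i else 0)
            fun i _ hlt => if_neg fun h => not_lt_of_not_lt_insert hlt yes no t h.1,
          ← hHy, ← hHn]
        have h1 := hy4 t τ
        have h2 := hn4 t τ
        simp only [Finset.sum_congr rfl fun i hi => congrArg (A.p i * ·) (hsy i hi t),
          Finset.sum_congr rfl fun i hi => congrArg (A.p i * ·) (hsn i hi t)]
        have e1 : ∀ i ∈ Hy, A.f i (E ∪ (((DecisionTree.node e yes no).path (A.S i)).take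
            (t + 1)).toFinset) = A.f i (insert e E ∪ ((yes.path (A.S i)).take t).toFinset) :=
          fun i hi => by rw [hyU i hi]
        have e2 : ∀ i ∈ Hn, A.f i (E ∪ (((DecisionTree.node e yes no).path (A.S i)).take
            (t + 1)).toFinset) = A.f i (insert e E ∪ ((no.path (A.S i)).take t).toFinset) :=
          fun i hi => by rw [hnU i hi]
        rw [Finset.sum_congr (s₁ := Hy) rfl fun i hi => by rw [e1 i hi],
          Finset.sum_congr (s₁ := Hn) rfl fun i hi => by rw [e2 i hi]]
        rw [Finset.sum_congr (s₁ := Hy) (f := fun i => if _ ∧ _ then A.p i else 0) rfl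
            fun i hi => by rw [e1 i hi],
          Finset.sum_congr (s₁ := Hn) (f := fun i => if _ ∧ _ then A.p i else 0) rfl
            fun i hi => by rw [e2 i hi]]
        linarith

end ASR
end AdaptiveRanking

/-! ### Multiple intent ranking: exactness of the model, `ε`, and the approximation factor -/

namespace AdaptiveRanking
namespace MIR

variable {n m : ℕ} (A : MIR n m)

theorem toASR_f_lt_one_iff (i : Fin m) (X : Finset (Fin n)) :
    A.toASR.f i X < 1 ↔ (X ∩ A.S i).card < A.K i := by
  have hK : (0 : ℝ) < A.K i := by exact_mod_cast A.K_pos i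
  show ((min (X ∩ A.S i).card (A.K i) : ℕ) : ℝ) / (A.K i : ℝ) < 1 ↔ _
  rw [div_lt_one hK, Nat.cast_lt]
  omega

theorem one_le_toASR_f_iff (i : Fin m) (X : List (Fin n)) :
    1 ≤ A.toASR.f i X.toFinset ↔ A.Satisfied i X := by
  rw [← not_lt, toASR_f_lt_one_iff, not_lt]
  rfl

theorem toASR_feasible_iff (T : DecisionTree (Fin n)) : A.toASR.Feasible T ↔ A.Feasible T :=
  forall_congr' fun i => A.one_le_toASR_f_iff i _

theorem K_le_maxK (i : Fin m) : A.K i ≤ A.maxK := Finset.le_sup (Finset.mem_univ i)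

theorem numTypes_pos {n m : ℕ} (A : MIR n m) : 0 < m := by
  rcases Nat.eq_zero_or_pos m with rfl | h
  · simpa using A.p_sum
  · exact h

theorem maxK_pos : 0 < A.maxK :=
  lt_of_lt_of_le (A.K_pos ⟨0, A.numTypes_pos⟩) (A.K_le_maxK _)

variable {A}

theorem Satisfied.mono {i : Fin m} {X Y : List (Fin n)} (h : A.Satisfied i X) (hXY : X ⊆ Y) :
    A.Satisfied i Y := by
  refine le_trans h (Finset.card_le_card (Finset.inter_subset_inter_right ?_))
  intro a ha
  rw [List.mem_toFinset] at ha ⊢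
  exact hXY ha

theorem Feasible.numResults_le {T : DecisionTree (Fin n)} (hT : A.Feasible T) (i : Fin m) :
    A.numResults T i ≤ (T.path (A.S i)).length :=
  Nat.sInf_le (by
    show A.Satisfied i _
    rw [List.take_length]
    exact hT i)

/-- Satisfaction persists along longer prefixes; feasibility keeps `sInf` from being taken over the
empty set, where it would be 0. -/
theorem Feasible.lt_numResults_iff {T : DecisionTree (Fin n)} (hT : A.Feasible T) (i : Fin m)
    (t : ℕ) : t < A.numResults T i ↔ A.toASR.f i ((T.path (A.S i)).take t).toFinset < 1 := by
  rw [← not_le, ← not_le, one_le_toASR_f_iff, not_iff_not]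
  refine ⟨fun h => ?_, fun h => Nat.sInf_le h⟩
  have hne : {k : ℕ | A.Satisfied i ((T.path (A.S i)).take k)}.Nonempty :=
    ⟨(T.path (A.S i)).length, by
      show A.Satisfied i _
      rw [List.take_length]
      exact hT i⟩
  exact Satisfied.mono (Nat.sInf_mem hne) (List.take_subset_take_left _ h)

theorem Feasible.expectedCost_toASR {T : DecisionTree (Fin n)} (hT : A.Feasible T) :
    A.toASR.expectedCost T = A.expectedCost T := by
  refine Finset.sum_congr rfl fun i _ => congrArg (A.p i * ·) ?_
  have h1 : sInf {k : ℕ | 1 ≤ A.toASR.f i ((T.path (A.toASR.S i)).take k).toFinset} =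
      A.numResults T i := by
    simp only [one_le_toASR_f_iff]
    rfl
  have h2 : (A.numResults T i) ≤ (T.path (A.toASR.S i)).length := hT.numResults_le i
  show ASR.cost _ _ _ = _
  rw [ASR.cost, h1]
  show (List.map (fun _ => (1 : ℝ)) _).sum = _
  rw [List.map_const', List.sum_replicate, List.length_take, min_eq_left h2]
  simp

variable (A)

theorem inv_maxK_le_of_lt {i : Fin m} {a b : ℕ} (h : a < b) :
    1 / (A.maxK : ℝ) ≤ (b : ℝ) / A.K i - (a : ℝ) / A.K i := by
  have hK : (0 : ℝ) < A.K i := by exact_mod_cast A.K_pos i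
  have h1 : (a : ℝ) + 1 ≤ b := by exact_mod_cast h
  have h2 : 1 / (A.maxK : ℝ) ≤ 1 / A.K i :=
    one_div_le_one_div_of_le hK (by exact_mod_cast A.K_le_maxK i)
  rw [← sub_div]
  exact h2.trans (div_le_div_of_nonneg_right (by linarith) hK.le)

theorem isLeast_positiveIncrements :
    IsLeast A.toASR.positiveIncrements (1 / (A.maxK : ℝ)) := by
  constructor
  -- The value is attained by a type of largest threshold when its first result is displayed.
  · obtain ⟨i, -, hi⟩ := Finset.exists_mem_eq_sup Finset.univ
      ⟨(⟨0, A.numTypes_pos⟩ : Fin m), Finset.mem_univ _⟩ A.K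
    have hi : A.maxK = A.K i := hi
    have hpos := A.K_pos i
    have hS : 0 < (A.S i).card := lt_of_lt_of_le hpos (A.K_le i)
    obtain ⟨e, he⟩ := Finset.card_pos.mp hS
    have h0 : A.toASR.f i ∅ = 0 := A.toASR.f_empty i
    have h1 : A.toASR.f i (insert e ∅) = 1 / (A.maxK : ℝ) := by
      show ((min (insert e ∅ ∩ A.S i).card (A.K i) : ℕ) : ℝ) / (A.K i : ℝ) = _
      rw [Finset.insert_inter_of_mem he, Finset.empty_inter, hi]
      simp [hpos]
    have h2 : (0 : ℝ) < A.maxK := by exact_mod_cast A.maxK_pos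
    refine ⟨i, ∅, e, ?_, ?_⟩
    · rw [h0, h1]; positivity
    · rw [h0, h1, sub_zero]
  · rintro x ⟨i, X, e, hlt, rfl⟩
    have hK : (0 : ℝ) < A.K i := by exact_mod_cast A.K_pos i
    refine A.inv_maxK_le_of_lt ?_
    have hlt : ((min (X ∩ A.S i).card (A.K i) : ℕ) : ℝ) / (A.K i : ℝ) <
      ((min (insert e X ∩ A.S i).card (A.K i) : ℕ) : ℝ) / (A.K i : ℝ) := hlt
    rw [div_lt_div_iff_of_pos_right hK] at hlt
    exact_mod_cast hlt

/-- A positive deficit is a positive multiple of `1 / A.K i`; this is the form in which `ε` enters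
the potential. -/
theorem inv_maxK_le_one_sub {i : Fin m} {X : Finset (Fin n)} (h : A.toASR.f i X < 1) :
    1 / (A.maxK : ℝ) ≤ 1 - A.toASR.f i X := by
  have hK : (0 : ℝ) < A.K i := by exact_mod_cast A.K_pos i
  rw [toASR_f_lt_one_iff] at h
  have := A.inv_maxK_le_of_lt (i := i) (a := min (X ∩ A.S i).card (A.K i)) (b := A.K i) (by omega)
  rwa [div_self hK.ne'] at this

variable {A}

/-- Layer-cake formula: a cost is the number of times at which its type is still unsatisfied. -/
theorem Feasible.expectedCost_eq_sum {T : DecisionTree (Fin n)} (hT : A.Feasible T) {N : ℕ}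
    (hN : ∀ i, A.numResults T i ≤ N) :
    A.expectedCost T = ∑ t ∈ Finset.range N, ∑ i,
      (if A.toASR.f i ((T.path (A.S i)).take t).toFinset < 1 then A.p i else 0) := by
  rw [Finset.sum_comm]
  refine Finset.sum_congr rfl fun i _ => ?_
  simp only [← hT.lt_numResults_iff i]
  rw [← Finset.sum_filter]
  have : (Finset.range N).filter (fun t => t < A.numResults T i) =
      Finset.range (A.numResults T i) := by
    ext t
    have := hN i
    simp only [Finset.mem_filter, Finset.mem_range]
    omega
  rw [this, Finset.sum_const, Finset.card_range, nsmul_eq_mul, mul_comm]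

theorem feasible_of_isGreedyTree {T : DecisionTree (Fin n)} (hT : A.toASR.IsGreedyTree T) :
    A.Feasible T := fun i => by
  have := ASR.IsGreedy.covers hT i (Finset.mem_univ i)
  rwa [Finset.empty_union, one_le_toASR_f_iff] at this

theorem expectedCost_le_of_isGreedyTree {T T₀ : DecisionTree (Fin n)}
    (hT : A.toASR.IsGreedyTree T) (hT₀ : A.Feasible T₀) :
    A.expectedCost T ≤
      4 * (Real.logb 2 m + 1 + Real.log A.maxK) * A.expectedCost T₀ := by
  classical
  have hfT := feasible_of_isGreedyTree hT
  have hmax : (0 : ℝ) < A.maxK := by exact_mod_cast A.maxK_pos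
  have hm : (1 : ℝ) ≤ m := by exact_mod_cast A.numTypes_pos
  obtain ⟨s, hs0, hs1, hs2, hs3⟩ := ASR.IsGreedy.exists_charging (fun _ => rfl)
    (one_div_pos.mpr hmax) (fun _ _ => A.inv_maxK_le_one_sub) T₀ hT
    (fun i _ => by rw [A.toASR.f_empty]; exact one_pos) (by simp)
  set B := Real.logb 2 m + 1 + Real.log A.maxK with hB
  have hB0 : 0 ≤ B := by
    have h1 := Real.logb_nonneg (b := 2) (by norm_num) hm
    have h2 := Real.log_nonneg (x := A.maxK) (by exact_mod_cast A.maxK_pos)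
    linarith
  replace hs2 : ∀ i N, ∑ t ∈ Finset.range N, s i t ≤ B := fun i N => by
    have := hs2 i (Finset.mem_univ i) N
    rwa [Finset.card_univ, Fintype.card_fin, A.toASR.f_empty, sub_zero, one_div_one_div] at this
  -- Any common horizon by which both trees have satisfied every type would do.
  set N := ∑ i, (A.numResults T i + A.numResults T₀ i) with hN
  have hNi : ∀ i, A.numResults T i + A.numResults T₀ i ≤ N := fun i =>
    Finset.single_le_sum (f := fun i => A.numResults T i + A.numResults T₀ i)
      (fun _ _ => Nat.zero_le _) (Finset.mem_univ i)
  rw [hfT.expectedCost_eq_sum (N := N) fun i => by have := hNi i; omega,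
    hT₀.expectedCost_eq_sum (N := N) fun i => by have := hNi i; omega]
  refine sum_le_four_mul_sum (s := fun t => ∑ i, A.p i * s i t) hB0
    (fun t => Finset.sum_nonneg fun i _ => ?_) (fun t => Finset.sum_nonneg fun i _ => ?_)
    (fun t => Finset.sum_nonneg fun i _ => ?_) ?_ (fun t τ => ?_) (fun t₀ => ?_)
  · split_ifs
    exacts [A.p_nonneg i, le_rfl]
  · exact mul_nonneg (A.p_nonneg i) (hs0 i t)
  · split_ifs
    exacts [A.p_nonneg i, le_rfl]
  · refine Finset.sum_eq_zero fun i _ => if_neg ?_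
    rw [← hT₀.lt_numResults_iff]
    have := hNi i
    omega
  · have h := hs3 t τ
    simp only [Finset.empty_union] at h
    refine h.trans (add_le_add le_rfl (Finset.sum_le_sum fun i _ => ?_))
    by_cases hV : A.toASR.f i ((T₀.path (A.S i)).take τ).toFinset < 1
    · rw [if_pos hV]
      split_ifs
      exacts [le_rfl, A.p_nonneg i]
    · rw [if_neg hV, if_neg fun h => hV h.2]
  -- Tail bound, type by type: a type unsatisfied at `t₀` is charged at most `B` in total, and one
  -- already satisfied is charged nothing from `t₀` on.
  · rw [Finset.sum_comm, Finset.mul_sum]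
    refine Finset.sum_le_sum fun i _ => ?_
    rw [← Finset.mul_sum]
    split_ifs with hU
    · rw [mul_comm B]
      refine mul_le_mul_of_nonneg_left (le_trans ?_ (hs2 i N)) (A.p_nonneg i)
      refine Finset.sum_le_sum_of_subset_of_nonneg ?_ fun t _ _ => hs0 i t
      intro t ht
      exact Finset.mem_range.mpr (Finset.mem_Ico.mp ht).2
    · rw [Finset.sum_eq_zero, mul_zero, mul_zero]
      intro t ht
      refine hs1 i (Finset.mem_univ i) t ?_
      rw [Finset.empty_union]
      rw [← hfT.lt_numResults_iff] at hU
      refine mt (hfT.lt_numResults_iff i t).mpr ?_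
      have := (Finset.mem_Ico.mp ht).1
      omega

theorem expectedCost_nonneg (T : DecisionTree (Fin n)) : 0 ≤ A.expectedCost T :=
  Finset.sum_nonneg fun i _ => mul_nonneg (A.p_nonneg i) (Nat.cast_nonneg _)

theorem expectedCost_le_mul_log {T T₀ : DecisionTree (Fin n)}
    (hT : A.toASR.IsGreedyTree T) (hT₀ : A.Feasible T₀) :
    A.expectedCost T ≤
      8 * (1 + Real.log A.maxK + Real.log m) * A.expectedCost T₀ := by
  refine (expectedCost_le_of_isGreedyTree hT hT₀).trans
    (mul_le_mul_of_nonneg_right ?_ (expectedCost_nonneg T₀))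
  have hm : (1 : ℝ) ≤ m := by exact_mod_cast A.numTypes_pos
  have h1 := Real.log_nonneg hm
  have h2 := Real.log_nonneg (x := A.maxK) (by exact_mod_cast A.maxK_pos)
  -- Since `log 2 > 1 / 2`; the resulting factor 2 turns the constant 4 into 8.
  have h3 : Real.logb 2 m ≤ 2 * Real.log m := by
    have := Real.log_two_gt_d9
    rw [Real.logb, div_le_iff₀ (by linarith)]
    nlinarith
  linarith

end MIR
end AdaptiveRanking

/-! ### Values and step counts of the basic programs -/

namespace AdaptiveRanking
namespace Timed

variable {α β : Type}

@[simp] theorem bind_val (x : Timed α) (g : α → Timed β) : (x >>= g).val = (g x.val).val := rfl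
@[simp] theorem bind_ticks (x : Timed α) (g : α → Timed β) :
    (x >>= g).ticks = x.ticks + (g x.val).ticks := rfl
@[simp] theorem tick_val (x : α) : (tick x).val = x := rfl
@[simp] theorem tick_ticks (x : α) : (tick x).ticks = 1 := rfl

@[simp] theorem filter_val (q : α → Timed Bool) (l : List α) :
    (filter q l).val = l.filter (fun a => (q a).val) := by
  induction l with
  | nil => rfl
  | cons a l ih => simp [filter, ih, List.filter_cons]

theorem filter_ticks_le {q : α → Timed Bool} {c : ℕ} {l : List α}
    (h : ∀ a ∈ l, (q a).ticks ≤ c) : (filter q l).ticks ≤ l.length * (c + 1) + 1 := by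
  induction l with
  | nil => simp [filter]
  | cons a l ih =>
    have h1 := h a (by simp)
    have h2 := ih fun b hb => h b (by simp [hb])
    simp only [filter, bind_ticks, tick_ticks, List.length_cons, add_mul]
    omega

@[simp] theorem length_val (l : List α) : (length l).val = l.length := by
  induction l with
  | nil => rfl
  | cons a l ih => simp [length, ih]

@[simp] theorem length_ticks (l : List α) : (length l).ticks = l.length + 1 := by
  induction l with
  | nil => rfl
  | cons a l ih => simp [length, ih]

@[simp] theorem sum_val (g : α → Timed ℝ) (l : List α) :
    (sum g l).val = (l.map fun a => (g a).val).sum := by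
  induction l with
  | nil => rfl
  | cons a l ih => simp [sum, ih]

theorem sum_ticks_le {g : α → Timed ℝ} {c : ℕ} {l : List α}
    (h : ∀ a ∈ l, (g a).ticks ≤ c) : (sum g l).ticks ≤ l.length * (c + 1) + 1 := by
  induction l with
  | nil => simp [sum]
  | cons a l ih =>
    have h1 := h a (by simp)
    have h2 := ih fun b hb => h b (by simp [hb])
    simp only [sum, bind_ticks, tick_ticks, List.length_cons, add_mul]
    omega

@[simp] theorem mem_val {n : ℕ} (e : Fin n) (l : List (Fin n)) :
    (mem e l).val = decide (e ∈ l) := by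
  induction l with
  | nil => simp [mem]
  | cons a l ih => simp [mem, ih]

@[simp] theorem mem_ticks {n : ℕ} (e : Fin n) (l : List (Fin n)) :
    (mem e l).ticks = 2 * l.length + 1 := by
  induction l with
  | nil => rfl
  | cons a l ih => simp [mem, ih]; ring

theorem argmax_val_eq_none {g : α → Timed ℝ} {l : List α} (h : (argmax g l).val = none) :
    l = [] := by
  cases l with
  | nil => rfl
  | cons a l =>
    simp only [argmax, bind_val] at h
    split at h
    · simp at h
    · simp only [tick_val] at h
      split at h <;> simp at h

theorem argmax_val_eq_some {g : α → Timed ℝ} {l : List α} {a : α} {x : ℝ}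
    (h : (argmax g l).val = some (a, x)) :
    a ∈ l ∧ x = (g a).val ∧ ∀ b ∈ l, (g b).val ≤ x := by
  induction l generalizing a x with
  | nil => simp [argmax] at h
  | cons c l ih =>
    simp only [argmax, bind_val] at h
    split at h
    · next hn =>
      have hl := argmax_val_eq_none hn
      subst hl
      simp only [tick_val, Option.some.injEq, Prod.mk.injEq] at h
      obtain ⟨rfl, rfl⟩ := h
      simp
    · next b y hb =>
      obtain ⟨h1, h2, h3⟩ := ih hb
      simp only [tick_val] at h
      split_ifs at h with hle
      · simp only [Option.some.injEq, Prod.mk.injEq] at h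
        obtain ⟨rfl, rfl⟩ := h
        refine ⟨by simp, rfl, ?_⟩
        intro d hd
        rcases List.mem_cons.mp hd with rfl | hd
        · exact le_rfl
        · exact (h3 d hd).trans hle
      · simp only [Option.some.injEq, Prod.mk.injEq] at h
        obtain ⟨rfl, rfl⟩ := h
        refine ⟨by simp [h1], h2, ?_⟩
        intro d hd
        rcases List.mem_cons.mp hd with rfl | hd
        · exact (not_le.mp hle).le
        · exact h3 d hd

theorem argmax_ticks_le {g : α → Timed ℝ} {c : ℕ} {l : List α}
    (h : ∀ a ∈ l, (g a).ticks ≤ c) : (argmax g l).ticks ≤ l.length * (c + 1) + 1 := by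
  induction l with
  | nil => simp [argmax]
  | cons a l ih =>
    have h1 := h a (by simp)
    have h2 := ih fun b hb => h b (by simp [hb])
    simp only [argmax, bind_ticks, List.length_cons, add_mul]
    split <;> simp only [tick_ticks] <;> omega

end Timed

/-! ### Correctness and running time of the implementation -/

namespace ASR

open Timed

variable {n m : ℕ} {A : ASR n m}

theorem minorityPart_val (H : List (Fin m)) (e : Fin n) :
    (A.minorityPart H e).val =
      if (H.filter (fun i => e ∈ A.S i)).length ≤ (H.filter (fun i => e ∉ A.S i)).length
      then H.filter (fun i => e ∈ A.S i) else H.filter (fun i => e ∉ A.S i) := by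
  simp [minorityPart]

theorem minorityPart_nodup {H : List (Fin m)} (hH : H.Nodup) (e : Fin n) :
    (A.minorityPart H e).val.Nodup := by
  rw [minorityPart_val]
  split_ifs <;> exact hH.filter _

theorem isMinorityPart_minorityPart {H : List (Fin m)} (hH : H.Nodup) (e : Fin n) :
    A.IsMinorityPart H.toFinset e (A.minorityPart H e).val.toFinset := by
  have h1 := List.toFinset_card_of_nodup (hH.filter (fun i => decide (e ∈ A.S i)))
  have h2 := List.toFinset_card_of_nodup (hH.filter (fun i => decide (e ∉ A.S i)))
  rw [List.toFinset_filter] at h1 h2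
  simp only [decide_eq_true_eq] at h1 h2
  unfold IsMinorityPart
  rw [minorityPart_val, h1, h2]
  split_ifs with h
  · exact Or.inl ⟨by rw [List.toFinset_filter]; simp, h⟩
  · exact Or.inr ⟨by rw [List.toFinset_filter]; simp, (not_le.mp h).le⟩

theorem minorityPart_ticks_le (H : List (Fin m)) (e : Fin n) :
    (A.minorityPart H e).ticks ≤ 6 * H.length + 5 := by
  have h1 := filter_ticks_le (q := fun i => tick (decide (e ∈ A.S i))) (c := 1) (l := H)
    fun _ _ => le_rfl
  have h2 := filter_ticks_le (q := fun i => tick (decide (e ∉ A.S i))) (c := 1) (l := H)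
    fun _ _ => le_rfl
  have h3 := List.length_filter_le (fun i => decide (e ∈ A.S i)) H
  have h4 := List.length_filter_le (fun i => decide (e ∉ A.S i)) H
  simp only [minorityPart, bind_ticks, tick_ticks, length_ticks, filter_val, tick_val]
  omega

theorem minorityPart_length_le (H : List (Fin m)) (e : Fin n) :
    (A.minorityPart H e).val.length ≤ H.length := by
  rw [minorityPart_val]
  split_ifs <;> exact List.length_filter_le _ _

variable {oracle : Fin m → List (Fin n) → Timed ℝ}

theorem computeScore_val
    (ho : ∀ i (X : List (Fin n)), X.Nodup → (oracle i X).val = A.f i X.toFinset)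
    {E : List (Fin n)} (hE : E.Nodup) {H : List (Fin m)} (hH : H.Nodup) {e : Fin n} (he : e ∉ E) :
    (A.computeScore oracle E H e).val =
      A.score E.toFinset H.toFinset (A.minorityPart H e).val.toFinset e := by
  have h1 : ∀ i, (oracle i (e :: E)).val = A.f i (insert e E.toFinset) := fun i => by
    rw [ho i _ (List.nodup_cons.mpr ⟨he, hE⟩), List.toFinset_cons]
  have h2 : ∀ i, (oracle i E).val = A.f i E.toFinset := fun i => ho i _ hE
  simp only [computeScore, bind_val, tick_val, sum_val, h1, h2, score]
  rw [List.sum_toFinset _ hH, List.sum_toFinset _ (minorityPart_nodup hH e)]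
  ring

theorem computeScore_ticks_le {c : ℕ} {E : List (Fin n)} {e : Fin n} (H : List (Fin m))
    (h1 : ∀ i, (oracle i (e :: E)).ticks ≤ c) (h2 : ∀ i, (oracle i E).ticks ≤ c) :
    (A.computeScore oracle E H e).ticks ≤ H.length * (2 * c + 14) + 10 := by
  have h3 := A.minorityPart_ticks_le H e
  have h4 := A.minorityPart_length_le H e
  have h5 := sum_ticks_le (g := fun j => tick (A.p j)) (c := 1)
    (l := (A.minorityPart H e).val) fun _ _ => le_rfl
  have h6 := sum_ticks_le (c := 2 * c + 5) (l := H) (g := fun i => do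
    let x ← oracle i (e :: E)
    let y ← oracle i E
    let d ← tick (x - y)
    let r ← tick (1 - y)
    let t ← tick (d / r)
    let w ← tick (A.p i)
    tick (w * t)) fun i _ => by
      have := h1 i
      have := h2 i
      simp only [bind_ticks, tick_ticks]
      omega
  have h7 : H.length * (2 * c + 14) = H.length * (2 * c + 5 + 1) + 8 * H.length := by ring
  simp only [computeScore, bind_ticks, tick_ticks] at h6 ⊢
  omega

/-- By `hk` the counter `k` is exactly the number of undisplayed elements. When none is left every
`f i` equals 1, so no scenario is uncovered and the cut-off cases of the program lose nothing. -/
theorem buildTree_isGreedy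
    (ho : ∀ i (X : List (Fin n)), X.Nodup → (oracle i X).val = A.f i X.toFinset)
    (k : ℕ) {E : List (Fin n)} (hE : E.Nodup) {H : List (Fin m)} (hH : H.Nodup)
    (hk : k + E.length = n) (hcov : ∀ i ∈ H, A.f i E.toFinset < 1) :
    A.IsGreedy E.toFinset H.toFinset (A.buildTree oracle k E H).val := by
  classical
  have hfull : E.toFinset = Finset.univ → H = [] := by
    intro h
    refine List.eq_nil_iff_forall_not_mem.mpr fun i hi => ?_
    have h1 := hcov i hi
    have h2 := A.f_mono i (A.S i) E.toFinset (by rw [h]; exact Finset.subset_univ _)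
    rw [A.f_full] at h2
    linarith
  induction k generalizing E H with
  | zero =>
    have h1 : E.toFinset = Finset.univ := by
      rw [← Finset.card_eq_iff_eq_univ, List.toFinset_card_of_nodup hE, Fintype.card_fin]
      omega
    rw [hfull h1]
    exact IsGreedy.finished _
  | succ k ih =>
    cases H with
    | nil => exact IsGreedy.finished _
    | cons j H =>
      set H' := j :: H with hH'
      rw [hH', buildTree, ← hH']
      simp only [bind_val, filter_val, mem_val, tick_val]
      split
      · next hn =>
        have h1 := argmax_val_eq_none hn
        have h2 : E.toFinset = Finset.univ := by
          refine Finset.eq_univ_iff_forall.mpr fun a => ?_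
          by_contra ha
          have h3 := (List.filter_eq_nil_iff.mp h1) a (List.mem_finRange a)
          simp at h3 ha
          exact ha h3
        exact absurd (hfull h2) (by simp [hH'])
      · next e x hs =>
        obtain ⟨h1, h2, h3⟩ := argmax_val_eq_some hs
        simp only [bind_val, filter_val, tick_val]
        have he : e ∉ E := by simpa using h1
        have hne : (e :: E).Nodup := List.nodup_cons.mpr ⟨he, hE⟩
        have hfilter : ∀ (P : Fin m → Prop) [DecidablePred P],
            ((H'.filter (fun i => decide ((oracle i (e :: E)).val < 1))).filter
              (fun i => decide (P i))).toFinset =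
            H'.toFinset.filter (fun i => P i ∧ A.f i (insert e E.toFinset) < 1) := by
          intro P _
          ext i
          simp [ho i _ hne]
        have hsub : ∀ (P : Fin m → Prop) [DecidablePred P], A.IsGreedy (e :: E).toFinset
            ((H'.filter (fun i => decide ((oracle i (e :: E)).val < 1))).filter
              (fun i => decide (P i))).toFinset
            (A.buildTree oracle k (e :: E)
              ((H'.filter (fun i => decide ((oracle i (e :: E)).val < 1))).filter
              (fun i => decide (P i)))).val := by
          intro P _
          have hc : ∀ i ∈ (H'.filter (fun i => decide ((oracle i (e :: E)).val < 1))).filter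
              (fun i => decide (P i)), A.f i (e :: E).toFinset < 1 := by
            intro i hi
            rw [List.mem_filter, List.mem_filter, ho i _ hne] at hi
            simpa using hi.1.2
          refine ih hne ((hH.filter _).filter _) (by simp; omega) hc ?_
          intro h
          refine List.eq_nil_iff_forall_not_mem.mpr fun i hi => ?_
          have h4 := hc i hi
          have h5 := A.f_mono i (A.S i) (e :: E).toFinset
            (by rw [h]; exact Finset.subset_univ _)
          rw [A.f_full] at h5
          linarith
        have hY := hsub (fun i => e ∈ A.S i)
        have hN := hsub (fun i => e ∉ A.S i)
        rw [hfilter, List.toFinset_cons] at hY hN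
        -- The minority lists the program computes serve as the tie-breaking choice `L`.
        refine IsGreedy.step _ _ ⟨j, by simp [hH']⟩
          (fun a => (A.minorityPart H' a).val.toFinset)
          (fun a => isMinorityPart_minorityPart hH a) e (by simpa using he) ?_ _ _ hY hN
        intro a ha
        have ha' : a ∉ E := by simpa using ha
        rw [← computeScore_val ho hE hH ha', ← computeScore_val ho hE hH he, ← h2]
        exact h3 a (by simp [ha'])

/-- A bound for the work at a single node when the oracle takes at most `c` steps. -/
def nodeWork (n m c : ℕ) : ℕ :=
  n * (2 * n + 3) + n * (m * (2 * c + 14) + 11) + m * (c + 2) + m * 4 + 6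

/-- The bound is linear in `H.length`, hence additive over the two branches, which split `H`; this
prevents exponential growth in the depth `k`. The summand 1 is the cost of a leaf. -/
theorem buildTree_ticks_le {c : ℕ}
    (hc : ∀ i (X : List (Fin n)), X.length ≤ n → (oracle i X).ticks ≤ c)
    (k : ℕ) {E : List (Fin n)} {H : List (Fin m)}
    (hk : k + E.length = n) (hH : H.length ≤ m) :
    (A.buildTree oracle k E H).ticks ≤ 1 + k * H.length * (nodeWork n m c + 1) := by
  induction k generalizing E H with
  | zero => simp [buildTree]
  | succ k ih =>
    cases H with
    | nil => simp [buildTree]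
    | cons j H =>
      set H' := j :: H with hH'
      rw [hH', buildTree, ← hH']
      set R := (Timed.filter (fun e => do
        let b ← Timed.mem e E
        tick (!b)) (List.finRange n)) with hR
      have hRt : R.ticks ≤ n * (2 * n + 3) + 1 := by
        have := filter_ticks_le (c := 2 * n + 2) (l := List.finRange n)
          (q := fun e => do
            let b ← Timed.mem e E
            tick (!b)) (by
          intro a _
          simp only [bind_ticks, mem_ticks, tick_ticks]
          omega)
        rwa [List.length_finRange] at this
      have hRl : R.val.length ≤ n := by
        rw [hR, filter_val]
        exact (List.length_filter_le _ _).trans (List.length_finRange).le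
      have hat : (argmax (A.computeScore oracle E H') R.val).ticks ≤
          n * (m * (2 * c + 14) + 11) + 1 := by
        refine (argmax_ticks_le (c := m * (2 * c + 14) + 10) fun e _ => ?_).trans ?_
        · refine (computeScore_ticks_le H' (c := c) (fun i => hc i _ ?_)
            (fun i => hc i _ ?_)).trans ?_
          · rw [List.length_cons]; omega
          · omega
          · have := Nat.mul_le_mul_right (2 * c + 14) hH
            omega
        · exact Nat.add_le_add_right (Nat.mul_le_mul_right (m * (2 * c + 14) + 10 + 1) hRl) 1
      have hpos : 1 ≤ H'.length := by simp [hH']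
      have hbig : nodeWork n m c + 1 ≤ (k + 1) * H'.length * (nodeWork n m c + 1) :=
        Nat.le_mul_of_pos_left _ (Nat.mul_pos (Nat.succ_pos k) hpos)
      simp only [bind_ticks]
      split
      · simp only [tick_ticks]
        unfold nodeWork at hbig ⊢
        omega
      · next e x hs =>
        simp only [bind_ticks, tick_ticks]
        set V := (Timed.filter (fun i => do
          let x ← oracle i (e :: E)
          tick (decide (x < 1))) H') with hV
        have hVt : V.ticks ≤ m * (c + 2) + 1 := by
          refine (filter_ticks_le (c := c + 1) fun i _ => ?_).trans ?_
          · have := hc i (e :: E) (by rw [List.length_cons]; omega)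
            simp only [bind_ticks, tick_ticks]
            omega
          · exact Nat.add_le_add_right (Nat.mul_le_mul_right (c + 1 + 1) hH) 1
        have hVl : V.val.length ≤ H'.length := by
          rw [hV, filter_val]
          exact List.length_filter_le _ _
        set Y := Timed.filter (fun i => tick (decide (e ∈ A.S i))) V.val with hY
        set N := Timed.filter (fun i => tick (decide (e ∉ A.S i))) V.val with hN
        have hYt : Y.ticks ≤ m * 2 + 1 := by
          refine (filter_ticks_le (c := 1) fun i _ => le_rfl).trans ?_
          omega
        have hNt : N.ticks ≤ m * 2 + 1 := by
          refine (filter_ticks_le (c := 1) fun i _ => le_rfl).trans ?_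
          omega
        have hYN : Y.val.length + N.val.length = V.val.length := by
          have h : ∀ l : List (Fin m),
              (Timed.filter (fun i => tick (decide (e ∈ A.S i))) l).val.length +
                (Timed.filter (fun i => tick (decide (e ∉ A.S i))) l).val.length = l.length := by
            intro l
            have := List.length_eq_length_filter_add (l := l) (fun i => decide (e ∈ A.S i))
            simp only [filter_val, tick_val, decide_not]
            exact this.symm
          exact h V.val
        have hEk : k + (e :: E).length = n := by rw [List.length_cons]; omega
        have h1 := ih (E := e :: E) (H := Y.val) hEk (by omega)
        have h2 := ih (E := e :: E) (H := N.val) hEk (by omega)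
        have h3 : k * Y.val.length * (nodeWork n m c + 1) +
            k * N.val.length * (nodeWork n m c + 1) ≤
            k * H'.length * (nodeWork n m c + 1) := by
          rw [← add_mul, ← mul_add, hYN]
          exact Nat.mul_le_mul_right _ (Nat.mul_le_mul_left _ hVl)
        have h4 : (k + 1) * H'.length * (nodeWork n m c + 1) =
            k * H'.length * (nodeWork n m c + 1) +
              H'.length * (nodeWork n m c + 1) := by ring
        -- One level of the bound covers the work at the node; its extra 1, with the leading 1 of
        -- the claim, covers the leading 1s of the two recursive bounds.
        have h5 : nodeWork n m c + 1 ≤ H'.length * (nodeWork n m c + 1) :=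
          Nat.le_mul_of_pos_left _ hpos
        have h6 : nodeWork n m c = n * (2 * n + 3) + n * (m * (2 * c + 14) + 11) +
          m * (c + 2) + m * 4 + 6 := rfl
        omega

end ASR

/-! ### The greedy program for multiple intent ranking -/

namespace MIR

open Timed

variable {n m : ℕ} (A : MIR n m)

theorem oracle_val (i : Fin m) {X : List (Fin n)} (hX : X.Nodup) :
    (A.oracle i X).val = A.toASR.f i X.toFinset := by
  have h : (X.filter (fun e => decide (e ∈ A.S i))).length = (X.toFinset ∩ A.S i).card := by
    rw [← List.toFinset_card_of_nodup (hX.filter _)]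
    congr 1
    ext e
    simp
  simp only [oracle, bind_val, tick_val, filter_val, length_val, h]
  rfl

theorem oracle_ticks_le (i : Fin m) (X : List (Fin n)) :
    (A.oracle i X).ticks ≤ 3 * X.length + 5 := by
  have h1 := filter_ticks_le (q := fun e => tick (decide (e ∈ A.S i))) (c := 1) (l := X)
    fun _ _ => le_rfl
  have h2 := List.length_filter_le (fun e => decide (e ∈ A.S i)) X
  simp only [oracle, bind_ticks, tick_ticks, length_ticks, filter_val, tick_val]
  omega

theorem isGreedyTree_algorithm : A.toASR.IsGreedyTree A.algorithm.val := by
  have h : A.toASR.IsGreedy [].toFinset (List.finRange m).toFinset A.algorithm.val :=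
    ASR.buildTree_isGreedy (fun i X hX => A.oracle_val i hX) n
    List.nodup_nil (List.nodup_finRange m) (by simp) fun i _ => by
      rw [List.toFinset_nil, A.toASR.f_empty]
      exact one_pos
  rwa [List.toFinset_nil, List.toFinset_finRange] at h

theorem algorithm_ticks_le : A.algorithm.ticks ≤ 200 * (n + m) ^ 5 := by
  have h : A.algorithm.ticks ≤
      1 + n * (List.finRange m).length * (ASR.nodeWork n m (3 * n + 5) + 1) :=
    ASR.buildTree_ticks_le (fun i X hX => (A.oracle_ticks_le i X).trans (by omega)) n
      (by simp) (by simp)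
  rw [List.length_finRange] at h
  refine le_trans h ?_
  obtain ⟨N, hN⟩ : ∃ N, N = n + m := ⟨_, rfl⟩
  have hm := A.numTypes_pos
  have hn : n ≤ N := by omega
  have hm' : m ≤ N := by omega
  have hN1 : 1 ≤ N := by omega
  rw [← hN]
  have h1 : ASR.nodeWork n m (3 * n + 5) ≤ ASR.nodeWork N N (3 * N + 5) := by
    unfold ASR.nodeWork
    gcongr
  have h2 : ASR.nodeWork N N (3 * N + 5) + 1 = 6 * N ^ 3 + 29 * N ^ 2 + 25 * N + 7 := by
    unfold ASR.nodeWork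
    ring
  have p1 : N ≤ N ^ 3 := Nat.le_self_pow (by norm_num) N
  have p2 : N ^ 2 ≤ N ^ 3 := Nat.pow_le_pow_right hN1 (by norm_num)
  have p5 : 1 ≤ N ^ 5 := Nat.one_le_pow _ _ hN1
  -- Here `67 = 6 + 29 + 25 + 7`, each power of `N` being at most `N ^ 3`; the final constant 200 is
  -- generous.
  have h3 : n * m * (ASR.nodeWork n m (3 * n + 5) + 1) ≤ N * N * (67 * N ^ 3) :=
    Nat.mul_le_mul (Nat.mul_le_mul hn hm') (by omega)
  have h4 : N * N * (67 * N ^ 3) = 67 * N ^ 5 := by ring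
  omega

end MIR
end AdaptiveRanking

theorem mainTheorem3 :
    ∃ (C : ℝ) (D d : ℕ), ∀ (n m : ℕ) (A : AdaptiveRanking.MIR n m),
      -- the model as adaptive submodular ranking is exact
      (∀ T : AdaptiveRanking.DecisionTree (Fin n),
        (A.toASR.Feasible T ↔ A.Feasible T) ∧
        (A.Feasible T → A.toASR.expectedCost T = A.expectedCost T)) ∧
      -- its parameter `ε` is `1 / max K_i`
      IsLeast A.toASR.positiveIncrements (1 / (A.maxK : ℝ)) ∧
      -- every outcome of the greedy algorithm is feasible and within the claimed factor of optimal
      (∀ T : AdaptiveRanking.DecisionTree (Fin n), A.toASR.IsGreedyTree T →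
        A.Feasible T ∧
        ∀ T₀ : AdaptiveRanking.DecisionTree (Fin n), A.Feasible T₀ →
          A.expectedCost T ≤
            C * (1 + Real.log (A.maxK : ℝ) + Real.log (m : ℝ)) * A.expectedCost T₀) ∧
      -- the algorithm can be implemented in polynomial time
      A.toASR.IsGreedyTree A.algorithm.val ∧
      A.algorithm.ticks ≤ D * (n + m) ^ d :=
  ⟨8, 200, 5, fun _ _ A =>
    ⟨fun T => ⟨A.toASR_feasible_iff T, fun hT => hT.expectedCost_toASR⟩,
      A.isLeast_positiveIncrements,
      fun _ hT => ⟨AdaptiveRanking.MIR.feasible_of_isGreedyTree hT,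
        fun _ hT₀ => AdaptiveRanking.MIR.expectedCost_le_mul_log hT hT₀⟩,
      A.isGreedyTree_algorithm, A.algorithm_ticks_le⟩⟩
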